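/- Let $\mathbb{D}=\{z\in\mathbb{C}:|z|<1\}$. Let $\mathcal{S}_{\mathcal{H}}^{0}$ denote the class of univalent (injective), sense-preserving (positive Jacobian), complex-valued harmonic functions $f$ in $\mathbb{D}$ with $f(0)=f_{\bar z}(0)=f_z(0)-1=0$. Each such $f$ is written uniquely as $f=h+\overline{g}$ with $h,g$ analytic in $\mathbb{D}$ and $g(0)=0$. For $f_j=h_j+\overline{g_j}\in\mathcal{S}_{\mathcal{H}}^{0}$ $(j=1,2)$ define the convolution $f_1*f_2=h_1*h_2+\overline{g_1*g_2}$, where $\left(\sum_n a_nz^n\right)*\left(\sum_n A_nz^n\right)=\sum_n a_nA_nz^n$. Theorem. Let $f_j=h_j+\overline{g_j}\in\mathcal{S}_{\mathcal{H}}^{0}$ $(j=1,2)$ satisfy $$h_1(z)-g_1(z)=\frac{z}{1-z},\qquad h_2(z)+g_2(z)=\frac12\log\frac{1+z}{1-z}\qquad(z\in\mathbb{D}),$$ where $\log$ is the principal branch. If $f_1*f_2$ is locally univalent in $\mathbb{D}$ (every point of $\mathbb{D}$ has a neighbourhood on which $f_1*f_2$ is injective), then $f_1*f_2$ is univalent in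 $\mathbb{D}$ and convex in the direction of the imaginary axis, i.e. $(f_1*f_2)(\mathbb{D})$ is a domain whose intersection with every vertical line is connected or empty. -/

import Mathlib

open Complex Set Topology

namespace HarmonicMapping

/-- The open unit disk in the complex plane. -/
def unitDisk : Set ℂ := Metric.ball (0 : ℂ) 1

/-- The Wirtinger derivative `f_z = (f_x - i f_y) / 2`. -/
noncomputable def dz (f : ℂ → ℂ) (z : ℂ) : ℂ :=
  (fderiv ℝ f z 1 - I * fderiv ℝ f z I) / 2

/-- The Wirtinger derivative `f_{z̄} = (f_x + i f_y) / 2`. -/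
noncomputable def dzbar (f : ℂ → ℂ) (z : ℂ) : ℂ :=
  (fderiv ℝ f z 1 + I * fderiv ℝ f z I) / 2

/-- The class `𝓗` of complex-valued harmonic functions in the unit disk, normalized by
`f(0) = f_{z̄}(0) = f_z(0) - 1 = 0`. -/
structure ClassH (f : ℂ → ℂ) : Prop where
  harmonic : InnerProductSpace.HarmonicOnNhd f unitDisk
  map_zero : f 0 = 0
  dzbar_zero : dzbar f 0 = 0
  dz_zero : dz f 0 = 1

/-- `f` is sense-preserving in the unit disk: its Jacobian (as a map of the real plane) is
positive there. -/
def SensePreserving (f : ℂ → ℂ) : Prop :=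
  ∀ z ∈ unitDisk, 0 < (fderiv ℝ f z).det

/-- `f` is univalent in the unit disk. -/
def Univalent (f : ℂ → ℂ) : Prop := InjOn f unitDisk

/-- `f` is locally univalent in the unit disk: every point of the disk has an open neighbourhood
in the disk on which `f` is injective. -/
def LocallyUnivalent (f : ℂ → ℂ) : Prop :=
  ∀ z ∈ unitDisk, ∃ U : Set ℂ, IsOpen U ∧ z ∈ U ∧ U ⊆ unitDisk ∧ InjOn f U

/-- The class `𝓢_𝓗⁰` of univalent and sense-preserving functions in `𝓗`. -/
structure ClassSH0 (f : ℂ → ℂ) : Prop where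
  classH : ClassH f
  univalent : Univalent f
  sensePreserving : SensePreserving f

/-- `f = h + conj g` in the unit disk, with `h` and `g` analytic there and `g(0) = 0`. These
conditions determine `h` and `g` in the disk. -/
structure IsCanonicalDecomposition (f h g : ℂ → ℂ) : Prop where
  analytic_h : DifferentiableOn ℂ h unitDisk
  analytic_g : DifferentiableOn ℂ g unitDisk
  g_zero : g 0 = 0
  eq_add_conj : ∀ z ∈ unitDisk, f z = h z + (starRingEnd ℂ) (g z)

/-- The `n`-th Taylor coefficient of `h` at the origin. -/
noncomputable def taylorCoeff (h : ℂ → ℂ) (n : ℕ) : ℂ :=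
  iteratedDeriv n h 0 / (n.factorial : ℂ)

/-- The convolution (Hadamard product) of two functions analytic in the unit disk:
the power series whose coefficients are the products of the Taylor coefficients. -/
noncomputable def analyticConv (h k : ℂ → ℂ) (z : ℂ) : ℂ :=
  ∑' n : ℕ, taylorCoeff h n * taylorCoeff k n * z ^ n

/-- The convolution of `h₁ + conj g₁` and `h₂ + conj g₂`, that is
`h₁ * h₂ + conj (g₁ * g₂)`. -/
noncomputable def harmonicConv (h₁ g₁ h₂ g₂ : ℂ → ℂ) (z : ℂ) : ℂ :=
  analyticConv h₁ h₂ z + (starRingEnd ℂ) (analyticConv g₁ g₂ z)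

theorem hasSum_taylorCoeff {h : ℂ → ℂ} (hh : DifferentiableOn ℂ h unitDisk) {z : ℂ}
    (hz : z ∈ unitDisk) : HasSum (fun n : ℕ => taylorCoeff h n * z ^ n) (h z) := by
  have := Complex.hasSum_taylorSeries_on_ball (c := (0 : ℂ)) (r := 1) (by simpa [unitDisk] using hh)
    (by simpa [unitDisk] using hz)
  refine this.congr_fun ?_
  intro n
  simp [taylorCoeff, smul_eq_mul, div_eq_mul_inv]
  ring

/-- The series defining the convolution of two analytic functions converges in the disk. -/
theorem summable_analyticConv {h k : ℂ → ℂ} (hh : DifferentiableOn ℂ h unitDisk)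
    (hk : DifferentiableOn ℂ k unitDisk) {z : ℂ} (hz : z ∈ unitDisk) :
    Summable (fun n : ℕ => taylorCoeff h n * taylorCoeff k n * z ^ n) := by
  have hz1 : ‖z‖ < 1 := by simpa [unitDisk] using hz
  set s : ℝ := Real.sqrt ‖z‖ with hs
  have hs0 : 0 ≤ s := Real.sqrt_nonneg _
  have hss : s * s = ‖z‖ := Real.mul_self_sqrt (norm_nonneg _)
  have hs1 : s < 1 := by nlinarith
  have hsD : (s : ℂ) ∈ unitDisk := by simpa [unitDisk, abs_of_nonneg hs0] using hs1
  have A := (hasSum_taylorCoeff hh hsD).summable.norm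
  have B := (hasSum_taylorCoeff hk hsD).summable.norm
  have C := A.mul_of_nonneg B (fun _ => norm_nonneg _) (fun _ => norm_nonneg _)
  have D := C.comp_injective (i := fun n : ℕ => (n, n)) (fun a b hab => by simpa using hab)
  refine Summable.of_norm ?_
  refine D.congr ?_
  intro n
  simp only [Function.comp, norm_mul, norm_pow, Complex.norm_real, Real.norm_eq_abs,
    abs_of_nonneg hs0, ← hss, mul_pow]
  ring

/-- A set is convex in the direction `γ` if its intersection with every line
`{a + t e^{iγ} : t ∈ ℝ}` is connected or empty. -/
def ConvexInDirection (γ : ℝ) (Ω : Set ℂ) : Prop :=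
  ∀ a : ℂ, IsPreconnected (Ω ∩ {w : ℂ | ∃ t : ℝ, w = a + (t : ℂ) * exp ((γ : ℂ) * I)})

/-- `f` maps the unit disk onto a domain (a nonempty connected open set) that is convex in the
direction of the imaginary axis. -/
def ConvexInImaginaryDirection (f : ℂ → ℂ) : Prop :=
  IsOpen (f '' unitDisk) ∧ IsConnected (f '' unitDisk) ∧
    ConvexInDirection (Real.pi / 2) (f '' unitDisk)

end HarmonicMapping

/-!
Write `φ = h₁ * h₂ + g₁ * g₂` (Hadamard products). The convolution `F = h₁ * h₂ + conj (g₁ * g₂)` has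
`Re F = Re φ`, and the proof has two halves.

**Positivity.** Convolution with `h₁ - g₁ = z / (1 - z)` fixes functions vanishing at `0`, so
`2 φ = (h₁ + g₁) * (h₂ + g₂) + (h₂ - g₂)`. Sense preservation makes `(hⱼ' + gⱼ') / (hⱼ' - gⱼ')` and its
inverse have positive real part. Hence `(1 - z²) (h₂ - g₂)'` has positive real part. With
`k = h₁ + g₁`, the function `(1 - z)² k'` has positive real part, and since `h₂ + g₂` has the
coefficients `1 / n` for odd `n` and `0` otherwise, `(k * (h₂ + g₂))'` equals
`(k (z) - k (-z)) / (2 z)`. In the coordinate `w = z / (1 - z)`, whose range is a half-plane and so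
convex, `(1 - z²) (k (z) - k (-z)) / (2 z)` is a mean of `dk/dw = (1 - z)² k'` along a segment
(`re_mul_sub_neg_div_nonneg`). Therefore `Re ((1 - z²) φ') > 0`
(`re_mul_deriv_analyticConv_add_pos`).

**Shear construction.** In the coordinate `ζ = ½ log ((1 + z) / (1 - z))` of the strip
`|Im ζ| < π / 4`, positivity says that `Re φ` is strictly increasing along horizontal lines. A level
set of `Re φ` is thus a graph over a set of heights `Im ζ`. A comparison argument on long rectangles
shows that this set of heights is an interval (`ordConnected_levelHeights`). Along such a level curve
`Re F` is constant, so the local injectivity of `F` makes `Im F` a locally injective continuous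
function on an interval, hence an injective one. This gives the univalence of `F`, the connectedness
of the vertical sections of its image, and, by the intermediate value theorem, the openness of the
image (`univalent_and_convexInImaginaryDirection`).
-/

namespace HarmonicMapping

/-! ### Power series in the unit disk -/

theorem hasFPowerSeriesAt_of_hasSum {c : ℕ → ℂ} {f : ℂ → ℂ}
    (hf : ∀ z ∈ unitDisk, HasSum (fun n => c n * z ^ n) (f z)) :
    HasFPowerSeriesAt f (FormalMultilinearSeries.ofScalars ℂ c) 0 := by
  have hr : (((1 / 2 : NNReal) : ENNReal)) ≤ (FormalMultilinearSeries.ofScalars ℂ c).radius := by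
    apply FormalMultilinearSeries.le_radius_of_summable
    have h : (((1 / 2 : ℝ) : ℂ)) ∈ unitDisk := by
      simp only [unitDisk, Metric.mem_ball, dist_zero_right, Complex.norm_real]
      norm_num
    have := (hf _ h).summable.norm
    refine this.congr fun n => ?_
    rw [FormalMultilinearSeries.ofScalars_norm]
    simp
  refine ⟨((1 / 2 : NNReal) : ENNReal), hr, by simp, ?_⟩
  intro y hy
  have hy' : y ∈ unitDisk := by
    simp only [Metric.mem_eball, edist_zero_right, unitDisk, Metric.mem_ball,
      dist_zero_right] at hy ⊢
    rw [enorm_eq_nnnorm, ENNReal.coe_lt_coe, ← NNReal.coe_lt_coe] at hy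
    norm_num at hy
    linarith
  simpa [FormalMultilinearSeries.ofScalars_apply_eq, mul_comm] using hf y hy'

theorem coeff_eq_of_hasSum {c c' : ℕ → ℂ} {f : ℂ → ℂ}
    (hf : ∀ z ∈ unitDisk, HasSum (fun n => c n * z ^ n) (f z))
    (hf' : ∀ z ∈ unitDisk, HasSum (fun n => c' n * z ^ n) (f z)) : c = c' :=
  FormalMultilinearSeries.ofScalars_series_injective (𝕜 := ℂ) (E := ℂ)
    ((hasFPowerSeriesAt_of_hasSum hf).eq_formalMultilinearSeries (hasFPowerSeriesAt_of_hasSum hf'))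

theorem isOpen_unitDisk : IsOpen unitDisk := Metric.isOpen_ball

theorem mem_unitDisk {z : ℂ} : z ∈ unitDisk ↔ ‖z‖ < 1 := by simp [unitDisk]

theorem differentiableAt_and_hasSum_mul_deriv {c : ℕ → ℂ} {f : ℂ → ℂ}
    (hf : ∀ z ∈ unitDisk, HasSum (fun n => c n * z ^ n) (f z)) {z : ℂ} (hz : z ∈ unitDisk) :
    DifferentiableAt ℂ f z ∧ HasSum (fun n : ℕ => n * c n * z ^ n) (z * deriv f z) := by
  obtain ⟨r, hr, hr1⟩ := exists_between (mem_unitDisk.1 hz)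
  have hr0 : 0 ≤ r := (norm_nonneg z).trans hr.le
  have hrD : (r : ℂ) ∈ unitDisk := by simpa [mem_unitDisk, abs_of_nonneg hr0] using hr1
  have hu := (hf _ hrD).summable.norm
  have hzr : z ∈ Metric.ball (0 : ℂ) r := by simpa using hr
  have hd : ∀ n : ℕ, DifferentiableOn ℂ (fun w : ℂ => c n * w ^ n) (Metric.ball 0 r) :=
    fun n => by fun_prop
  have hle : ∀ (n : ℕ) (w : ℂ), w ∈ Metric.ball (0 : ℂ) r →
      ‖c n * w ^ n‖ ≤ ‖c n * (r : ℂ) ^ n‖ := by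
    intro n w hw
    have hw' : ‖w‖ < r := by simpa using hw
    simp only [norm_mul, norm_pow, Complex.norm_real, Real.norm_eq_abs, abs_of_nonneg hr0]
    gcongr
  have hev : (fun w : ℂ => ∑' n : ℕ, c n * w ^ n) =ᶠ[𝓝 z] f := by
    filter_upwards [isOpen_unitDisk.mem_nhds hz] with w hw using (hf w hw).tsum_eq
  have h1 := (differentiableOn_tsum_of_summable_norm hu hd Metric.isOpen_ball hle).differentiableAt
    (Metric.isOpen_ball.mem_nhds hzr)
  have h2 := hasSum_deriv_of_summable_norm hu hd Metric.isOpen_ball hle hzr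
  rw [hev.deriv_eq] at h2
  refine ⟨h1.congr_of_eventuallyEq hev.symm, (h2.mul_left z).congr_fun fun n => ?_⟩
  rcases n with _ | n
  · simp
  · simp only [deriv_const_mul_field, deriv_pow_field, Nat.add_sub_cancel]
    ring

theorem deriv_zero_eq_coeff_one {c : ℕ → ℂ} {f : ℂ → ℂ}
    (hf : ∀ z ∈ unitDisk, HasSum (fun n => c n * z ^ n) (f z)) : deriv f 0 = c 1 := by
  have := (hasFPowerSeriesAt_of_hasSum hf).deriv
  rw [this]
  simp

theorem hasSum_analyticConv {h k : ℂ → ℂ} (hh : DifferentiableOn ℂ h unitDisk)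
    (hk : DifferentiableOn ℂ k unitDisk) {z : ℂ} (hz : z ∈ unitDisk) :
    HasSum (fun n : ℕ => taylorCoeff h n * taylorCoeff k n * z ^ n) (analyticConv h k z) :=
  (summable_analyticConv hh hk hz).hasSum

theorem one_sub_ne_zero_of_mem_unitDisk {z : ℂ} (hz : z ∈ unitDisk) : 1 - z ≠ 0 := by
  rintro h
  rw [mem_unitDisk, ← sub_eq_zero.1 h] at hz
  simp at hz

theorem neg_mem_unitDisk {z : ℂ} (hz : z ∈ unitDisk) : -z ∈ unitDisk := by
  rwa [mem_unitDisk, norm_neg, ← mem_unitDisk]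

theorem one_add_ne_zero_of_mem_unitDisk {z : ℂ} (hz : z ∈ unitDisk) : 1 + z ≠ 0 := by
  simpa using one_sub_ne_zero_of_mem_unitDisk (neg_mem_unitDisk hz)

/-! ### The half-plane map and the strip map -/

theorem hasSum_div_one_sub {z : ℂ} (hz : z ∈ unitDisk) :
    HasSum (fun n : ℕ => (if n = 0 then 0 else 1 : ℂ) * z ^ n) (z / (1 - z)) := by
  have h := (hasSum_geometric_of_norm_lt_one (mem_unitDisk.1 hz)).sub
    (hasSum_ite_eq (0 : ℕ) (1 : ℂ))
  have e : (1 - z)⁻¹ - 1 = z / (1 - z) := by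
    field_simp [one_sub_ne_zero_of_mem_unitDisk hz]; ring
  rw [e] at h
  refine h.congr_fun fun n => ?_
  by_cases hn : n = 0 <;> simp [hn]

theorem hasSum_div_one_sub_sq {z : ℂ} (hz : z ∈ unitDisk) :
    HasSum (fun n : ℕ => (if Odd n then 1 else 0 : ℂ) * z ^ n) (z / (1 - z ^ 2)) := by
  have h := ((hasSum_geometric_of_norm_lt_one (mem_unitDisk.1 hz)).sub
    (hasSum_geometric_of_norm_lt_one (mem_unitDisk.1 (neg_mem_unitDisk hz)))).mul_left (1 / 2)
  have h1 := one_sub_ne_zero_of_mem_unitDisk hz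
  have h2 := one_add_ne_zero_of_mem_unitDisk hz
  have e : 1 / 2 * ((1 - z)⁻¹ - (1 - -z)⁻¹) = z / (1 - z ^ 2) := by
    rw [show 1 - z ^ 2 = (1 - z) * (1 + z) by ring, sub_neg_eq_add]
    field_simp; ring
  rw [e] at h
  refine h.congr_fun fun n => ?_
  rcases Nat.even_or_odd n with hn | hn
  · simp [Nat.not_odd_iff_even.2 hn, hn.neg_pow]
  · simp [hn, hn.neg_pow]; ring

theorem re_one_add_div_one_sub_pos {z : ℂ} (hz : z ∈ unitDisk) :
    0 < ((1 + z) / (1 - z)).re := by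
  have h1 := one_sub_ne_zero_of_mem_unitDisk hz
  have h := mem_unitDisk.1 hz
  have h2 : z.re * z.re + z.im * z.im < 1 := by
    rw [← Complex.normSq_apply, Complex.normSq_eq_norm_sq]
    nlinarith [norm_nonneg z]
  rw [Complex.div_re, ← add_div]
  apply div_pos _ (Complex.normSq_pos.2 h1)
  simp
  nlinarith

theorem hasDerivAt_half_log {z : ℂ} (hz : z ∈ unitDisk) :
    HasDerivAt (fun z => (1 / 2 : ℂ) * Complex.log ((1 + z) / (1 - z))) (1 / (1 - z ^ 2)) z := by
  have h1 := one_sub_ne_zero_of_mem_unitDisk hz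
  have h2 := one_add_ne_zero_of_mem_unitDisk hz
  have h3 : (1 + z) / (1 - z) ∈ slitPlane := Or.inl (re_one_add_div_one_sub_pos hz)
  have hd := ((((hasDerivAt_id z).const_add 1).div ((hasDerivAt_id z).const_sub 1) h1).clog
    h3).const_mul (1 / 2 : ℂ)
  refine hd.congr_deriv ?_
  rw [show 1 - z ^ 2 = (1 - z) * (1 + z) by ring]
  simp only [Pi.div_apply, id_eq]
  field_simp
  ring

/-! ### Level sets of monotone harmonic functions in a strip -/

/-- The horizontal strip of half-width `a` about the real axis. -/
def strip (a : ℝ) : Set ℂ := {ζ | |ζ.im| < a}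

theorem isOpen_strip (a : ℝ) : IsOpen (strip a) :=
  isOpen_lt (by fun_prop) (by fun_prop)

theorem ofReal_add_mul_I_mem_strip {a η : ℝ} (ξ : ℝ) (hη : |η| < a) :
    (ξ + η * I : ℂ) ∈ strip a := by
  simpa [strip] using hη

/-- The heights `η` in `(-a, a)` for which `Re P` takes the value `c` on the line `Im ζ = η`. -/
def levelHeights (a : ℝ) (P : ℂ → ℂ) (c : ℝ) : Set ℝ :=
  {η | |η| < a ∧ ∃ ξ : ℝ, (P (ξ + η * I)).re = c}

/-- The maximum principle for real parts, on a rectangle. -/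
theorem re_le_re_of_frontier_rectangle {f g : ℂ → ℂ} {a b p q : ℝ} (hab : a < b) (hpq : p < q)
    (hf : DiffContOnCl ℂ f (Ioo a b ×ℂ Ioo p q)) (hg : DiffContOnCl ℂ g (Ioo a b ×ℂ Ioo p q))
    (hv : ∀ x, (x = a ∨ x = b) → ∀ y ∈ Icc p q, (g (x + y * I)).re ≤ (f (x + y * I)).re)
    (hh : ∀ x ∈ Icc a b, ∀ y, (y = p ∨ y = q) → (g (x + y * I)).re ≤ (f (x + y * I)).re)
    {x y : ℝ} (hx : x ∈ Icc a b) (hy : y ∈ Icc p q) :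
    (g (x + y * I)).re ≤ (f (x + y * I)).re := by
  have hd : DiffContOnCl ℂ (fun ζ => Complex.exp (g ζ - f ζ)) (Ioo a b ×ℂ Ioo p q) :=
    Complex.differentiable_exp.comp_diffContOnCl (hg.sub hf)
  have key : ∀ ζ, ‖Complex.exp (g ζ - f ζ)‖ ≤ 1 ↔ (g ζ).re ≤ (f ζ).re := by
    intro ζ
    rw [Complex.norm_exp, Real.exp_le_one_iff, sub_re, sub_nonpos]
  have hb := (Metric.isBounded_Ioo a b).reProdIm (Metric.isBounded_Ioo p q)
  rw [← key]
  refine norm_le_of_forall_mem_frontier_norm_le hb hd (fun w hw => ?_) ?_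
  · rw [key]
    rw [frontier_reProdIm, closure_Ioo hab.ne, closure_Ioo hpq.ne, frontier_Ioo hab,
      frontier_Ioo hpq] at hw
    rw [← Complex.re_add_im w]
    rcases hw with ⟨h1, h2⟩ | ⟨h1, h2⟩
    · exact hh _ h1 _ (by simpa using h2)
    · exact hv _ (by simpa using h1) _ h2
  · rw [closure_reProdIm, closure_Ioo hab.ne, closure_Ioo hpq.ne]
    simp only [mem_reProdIm]
    simpa using ⟨hx, hy⟩

theorem abs_lt_of_mem_Icc {a η η₁ η₂ : ℝ} (h₁ : |η₁| < a) (h₂ : |η₂| < a)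
    (hη : η ∈ Icc η₁ η₂) : |η| < a :=
  abs_lt.2 ⟨(abs_lt.1 h₁).1.trans_le hη.1, hη.2.trans_lt (abs_lt.1 h₂).2⟩

/-- If `Re Φ` increases along horizontal lines and eventually exceeds `c` on two of them, then it
exceeds `c` somewhere on each line between them. On a long rectangle between the two lines `Re Φ`
is compared with the real part of `c + ε - k * cosh (α * (ζ - ζ₀))`, where `ζ₀` is the centre of the
rectangle: this is at most `c + ε` on the horizontal sides, very negative on the vertical sides, and
above `c` on the vertical line through the centre. -/
theorem exists_lt_re_of_exists_lt_re {a c η η₁ η₂ X : ℝ} {Φ : ℂ → ℂ}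
    (hΦ : DifferentiableOn ℂ Φ (strip a))
    (hmono : ∀ η : ℝ, |η| < a → StrictMono fun ξ : ℝ => (Φ (ξ + η * I)).re)
    (ha₁ : |η₁| < a) (ha₂ : |η₂| < a) (h₁ : η₁ < η) (h₂ : η < η₂)
    (hc₁ : c < (Φ (X + η₁ * I)).re) (hc₂ : c < (Φ (X + η₂ * I)).re) :
    ∃ ξ : ℝ, c < (Φ (ξ + η * I)).re := by
  have h12 : η₁ < η₂ := h₁.trans h₂
  have hin : ∀ y ∈ Icc η₁ η₂, |y| < a := fun y hy => abs_lt_of_mem_Icc ha₁ ha₂ hy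
  obtain ⟨ε, hε, hε₁, hε₂⟩ : ∃ ε > 0, c + ε ≤ (Φ (X + η₁ * I)).re ∧
      c + ε ≤ (Φ (X + η₂ * I)).re :=
    ⟨min ((Φ (X + η₁ * I)).re - c) ((Φ (X + η₂ * I)).re - c), by simp [hc₁, hc₂],
      by linarith [min_le_left ((Φ (X + η₁ * I)).re - c) ((Φ (X + η₂ * I)).re - c)],
      by linarith [min_le_right ((Φ (X + η₁ * I)).re - c) ((Φ (X + η₂ * I)).re - c)]⟩
  obtain ⟨M, hM⟩ : ∃ M : ℝ, ∀ y ∈ Icc η₁ η₂, M ≤ (Φ (X + y * I)).re := by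
    have hcont : ContinuousOn (fun y : ℝ => (Φ (X + y * I)).re) (Icc η₁ η₂) := by
      refine Complex.continuous_re.comp_continuousOn (hΦ.continuousOn.comp (by fun_prop) ?_)
      exact fun y hy => ofReal_add_mul_I_mem_strip X (hin y hy)
    obtain ⟨M, hM⟩ := (isCompact_Icc.image_of_continuousOn hcont).bddBelow
    exact ⟨M, fun y hy => hM (mem_image_of_mem _ hy)⟩
  have hge : ∀ x, X ≤ x → ∀ y ∈ Icc η₁ η₂, (Φ (X + y * I)).re ≤ (Φ (x + y * I)).re :=
    fun x hx y hy => (hmono y (hin y hy)).monotone hx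
  set α : ℝ := Real.pi / (2 * (η₂ - η₁)) with hα
  set m : ℝ := (η₁ + η₂) / 2 with hm
  have hd : 0 < η₂ - η₁ := sub_pos.2 h12
  have hα0 : 0 < α := by positivity
  have hcos : ∀ y ∈ Icc η₁ η₂, Real.cos (Real.pi / 4) ≤ Real.cos (α * (y - m)) := by
    intro y hy
    rw [← Real.cos_abs (α * (y - m))]
    refine Real.cos_le_cos_of_nonneg_of_le_pi (abs_nonneg _) (by linarith [Real.pi_pos]) ?_
    have h3 : |y - m| ≤ (η₂ - η₁) / 2 := by
      rw [abs_le, hm]; constructor <;> linarith [hy.1, hy.2]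
    calc |α * (y - m)| = α * |y - m| := by rw [abs_mul, abs_of_pos hα0]
      _ ≤ α * ((η₂ - η₁) / 2) := by gcongr
      _ = Real.pi / 4 := by rw [hα]; field_simp; norm_num
  have hκ : 0 < Real.cos (Real.pi / 4) :=
    Real.cos_pos_of_mem_Ioo ⟨by linarith [Real.pi_pos], by linarith [Real.pi_pos]⟩
  set K : ℝ := |c + ε - M| / Real.cos (Real.pi / 4) with hK
  have hK0 : 0 ≤ K := by positivity
  have hKκ : c + ε - M ≤ K * Real.cos (Real.pi / 4) := by
    rw [hK, div_mul_cancel₀ _ hκ.ne']; exact le_abs_self _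
  -- a half-length for which `k = K / cosh (α * l)` is less than `ε`
  set l : ℝ := (2 * K / ε) / α + 1 / α with hl
  have hl0 : 0 < l := by positivity
  have hαl : α * l = 2 * K / ε + 1 := by rw [hl]; field_simp
  set C : ℝ := Real.cosh (α * l) with hC
  have hC0 : 0 < C := Real.cosh_pos _
  have hCK : K / C < ε := by
    rw [div_lt_iff₀ hC0]
    have h4 : 2 * K / ε + 2 ≤ 2 * C := by
      rw [hC, Real.cosh_eq]
      have h5 := Real.add_one_le_exp (α * l)
      have h6 := Real.exp_pos (-(α * l))
      rw [hαl] at h5 h6 ⊢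
      linarith
    have h7 : K / ε < C := by
      have : 2 * K / ε = 2 * (K / ε) := by ring
      linarith
    rw [div_lt_iff₀ hε] at h7
    linarith
  have hKC : 0 ≤ K / C := by positivity
  set Ψ : ℂ → ℂ := fun ζ =>
    ((c + ε : ℝ) : ℂ) - ((K / C : ℝ) : ℂ) * Complex.cosh (α * (ζ - (((X + l : ℝ) : ℂ) + m * I)))
    with hΨ
  have hΨre : ∀ x y : ℝ, (Ψ (x + y * I)).re =
      c + ε - K / C * (Real.cosh (α * (x - (X + l))) * Real.cos (α * (y - m))) := by
    intro x y
    have e : (α : ℂ) * (((x : ℂ) + y * I) - (((X + l : ℝ) : ℂ) + m * I)) =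
        ((α * (x - (X + l)) : ℝ) : ℂ) + ((α * (y - m) : ℝ) : ℂ) * I := by
      push_cast; ring
    simp only [hΨ]
    rw [e, Complex.cosh_add, Complex.cosh_mul_I, Complex.sinh_mul_I, sub_re, re_ofReal_mul, ofReal_re]
    rw [← ofReal_cosh, ← ofReal_cos, ← ofReal_sinh, ← ofReal_sin]
    simp only [add_re, mul_re, mul_im, ofReal_re, ofReal_im, I_re, I_im]
    ring
  have hΨd : Differentiable ℂ Ψ := by
    simp only [hΨ]
    fun_prop
  have hXb : X < X + 2 * l := by linarith
  have hΦd : DiffContOnCl ℂ Φ (Ioo X (X + 2 * l) ×ℂ Ioo η₁ η₂) := by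
    refine DifferentiableOn.diffContOnCl (hΦ.mono ?_)
    rw [closure_reProdIm, closure_Ioo hXb.ne, closure_Ioo h12.ne]
    exact fun ζ hζ => hin _ hζ.2
  refine ⟨X + l, lt_of_lt_of_le ?_ (re_le_re_of_frontier_rectangle hXb h12 hΦd
    hΨd.diffContOnCl ?_ ?_ (x := X + l) (y := η) ⟨by linarith, by linarith⟩ ⟨h₁.le, h₂.le⟩)⟩
  · rw [hΨre, sub_self, mul_zero, Real.cosh_zero, one_mul]
    have := mul_le_mul_of_nonneg_left (Real.cos_le_one (α * (η - m))) hKC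
    linarith
  · intro x hx y hy
    have hcosh : Real.cosh (α * (x - (X + l))) = C := by
      rcases hx with rfl | rfl
      · rw [show α * (x - (x + l)) = -(α * l) by ring, Real.cosh_neg]
      · rw [show α * (X + 2 * l - (X + l)) = α * l by ring]
    have hxX : X ≤ x := by rcases hx with rfl | rfl <;> linarith
    rw [hΨre, hcosh, ← mul_assoc, div_mul_cancel₀ _ hC0.ne']
    have := mul_le_mul_of_nonneg_left (hcos y hy) hK0
    linarith [hM y hy, hge x hxX y hy]
  · intro x hx y hy
    have hy' : y ∈ Icc η₁ η₂ := by rcases hy with rfl | rfl <;> simp [h12.le]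
    have h8 : c + ε ≤ (Φ (X + y * I)).re := by rcases hy with rfl | rfl <;> assumption
    have h9 : 0 ≤ K / C * (Real.cosh (α * (x - (X + l))) * Real.cos (α * (y - m))) :=
      mul_nonneg hKC (mul_nonneg (Real.cosh_pos _).le (hκ.le.trans (hcos y hy')))
    rw [hΨre]
    linarith [hge x hx.1 y hy']

/-- A level set of `Re Φ` projects onto an interval of heights. -/
theorem ordConnected_levelHeights {a : ℝ} {Φ : ℂ → ℂ} (hΦ : DifferentiableOn ℂ Φ (strip a))
    (hmono : ∀ η : ℝ, |η| < a → StrictMono fun ξ : ℝ => (Φ (ξ + η * I)).re) (c : ℝ) :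
    OrdConnected (levelHeights a Φ c) := by
  refine ordConnected_of_Ioo ?_
  rintro η₁ ⟨ha₁, ξ₁, hξ₁⟩ η₂ ⟨ha₂, ξ₂, hξ₂⟩ - η ⟨h₁, h₂⟩
  have ha : |η| < a := abs_lt_of_mem_Icc ha₁ ha₂ ⟨h₁.le, h₂.le⟩
  obtain ⟨x, hx⟩ : ∃ ξ : ℝ, c < (Φ (ξ + η * I)).re := by
    refine exists_lt_re_of_exists_lt_re (X := max ξ₁ ξ₂ + 1) hΦ hmono ha₁ ha₂ h₁ h₂ ?_ ?_
    · rw [← hξ₁]; exact hmono η₁ ha₁ (by linarith [le_max_left ξ₁ ξ₂])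
    · rw [← hξ₂]; exact hmono η₂ ha₂ (by linarith [le_max_right ξ₁ ξ₂])
  -- the same argument for `ζ ↦ -Φ (-ζ)` gives a value below `c`
  obtain ⟨y, hy⟩ : ∃ ξ : ℝ, (Φ (ξ + η * I)).re < c := by
    have hneg : ∀ ξ η : ℝ, (-((ξ : ℂ) + η * I)) = ((-ξ : ℝ) : ℂ) + ((-η : ℝ) : ℂ) * I := by
      intro ξ η; push_cast; ring
    have hΦ' : DifferentiableOn ℂ (fun ζ => -Φ (-ζ)) (strip a) :=
      (hΦ.comp differentiable_neg.differentiableOn fun ζ hζ => by simpa [strip] using hζ).neg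
    have hmono' : ∀ η : ℝ, |η| < a → StrictMono fun ξ : ℝ => (-Φ (-(ξ + η * I))).re := by
      intro η hη ξ ξ' h
      simp only [hneg, neg_re, neg_lt_neg_iff]
      exact hmono (-η) (by rwa [abs_neg]) (neg_lt_neg h)
    obtain ⟨y, hy⟩ := exists_lt_re_of_exists_lt_re (a := a) (c := -c) (η := -η) (η₁ := -η₂)
      (η₂ := -η₁) (X := -min ξ₁ ξ₂ + 1) hΦ' hmono' (by rwa [abs_neg]) (by rwa [abs_neg])
      (neg_lt_neg h₂) (neg_lt_neg h₁)
      (by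
        simp only [hneg, neg_re, neg_lt_neg_iff, neg_neg]
        rw [← hξ₂]; exact hmono η₂ ha₂ (by linarith [min_le_right ξ₁ ξ₂]))
      (by
        simp only [hneg, neg_re, neg_lt_neg_iff, neg_neg]
        rw [← hξ₁]; exact hmono η₁ ha₁ (by linarith [min_le_left ξ₁ ξ₂]))
    refine ⟨-y, ?_⟩
    simpa only [hneg, neg_re, neg_lt_neg_iff, neg_neg] using hy
  have hcont : Continuous fun ξ : ℝ => (Φ (ξ + η * I)).re := by
    refine Complex.continuous_re.comp (hΦ.continuousOn.comp_continuous (by fun_prop) ?_)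
    exact fun ξ => ofReal_add_mul_I_mem_strip ξ ha
  exact ⟨ha, mem_range_of_exists_le_of_exists_ge hcont ⟨y, hy.le⟩ ⟨x, hx.le⟩⟩

/-! ### Locally injective maps that are monotone along horizontal lines -/

theorem not_isLocalExtr_of_injOn {f : ℝ → ℝ} {x : ℝ} {N : Set ℝ} (hN : N ∈ 𝓝 x)
    (hf : ContinuousOn f N) (hinj : InjOn f N) : ¬ IsLocalExtr f x := by
  obtain ⟨δ, hδ, hsub⟩ := Metric.nhds_basis_closedBall.mem_iff.1 hN
  rw [Real.closedBall_eq_Icc] at hsub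
  have hle : x - δ ≤ x + δ := by linarith
  have hm := (hf.mono hsub).strictMonoOn_of_injOn_Icc' hle (hinj.mono hsub)
  have hL : ∀ᶠ y in 𝓝[<] x, y ∈ Ioo (x - δ) x := Ioo_mem_nhdsLT (by linarith)
  have hR : ∀ᶠ y in 𝓝[>] x, y ∈ Ioo x (x + δ) := Ioo_mem_nhdsGT (by linarith)
  have hx : x ∈ Icc (x - δ) (x + δ) := ⟨by linarith, by linarith⟩
  have hIL : ∀ y ∈ Ioo (x - δ) x, y ∈ Icc (x - δ) (x + δ) := fun y hy =>
    ⟨hy.1.le, by linarith [hy.2]⟩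
  have hIR : ∀ y ∈ Ioo x (x + δ), y ∈ Icc (x - δ) (x + δ) := fun y hy =>
    ⟨by linarith [hy.1], hy.2.le⟩
  rintro (h | h)
  · obtain ⟨y, hy, hy'⟩ := (hL.and (h.filter_mono nhdsWithin_le_nhds)).exists
    obtain ⟨z, hz, hz'⟩ := (hR.and (h.filter_mono nhdsWithin_le_nhds)).exists
    rcases hm with hm | hm
    · exact absurd (hm (hIL y hy) hx hy.2) (not_lt.2 hy')
    · exact absurd (hm hx (hIR z hz) hz.1) (not_lt.2 hz')
  · obtain ⟨y, hy, hy'⟩ := (hL.and (h.filter_mono nhdsWithin_le_nhds)).exists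
    obtain ⟨z, hz, hz'⟩ := (hR.and (h.filter_mono nhdsWithin_le_nhds)).exists
    rcases hm with hm | hm
    · exact absurd (hm hx (hIR z hz) hz.1) (not_lt.2 hz')
    · exact absurd (hm (hIL y hy) hx hy.2) (not_lt.2 hy')

theorem injOn_of_locally_injOn {f : ℝ → ℝ} {E : Set ℝ} (hE : OrdConnected E)
    (hf : ContinuousOn f E) (hloc : ∀ x ∈ E, ∃ N ∈ 𝓝 x, N ⊆ E ∧ InjOn f N) : InjOn f E := by
  intro x hx y hy hxy
  wlog hlt : x ≤ y generalizing x y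
  · exact (this hy hx hxy.symm (not_le.1 hlt).le).symm
  by_contra hne
  have hlt' : x < y := lt_of_le_of_ne hlt hne
  have hI : Icc x y ⊆ E := hE.out hx hy
  obtain ⟨z, hz, hext⟩ := exists_Ioo_extr_on_Icc hlt' (hf.mono hI) hxy
  obtain ⟨N, hN, hNE, hinj⟩ := hloc z (hI (Ioo_subset_Icc_self hz))
  exact not_isLocalExtr_of_injOn hN (hf.mono hNE) hinj (hext.isLocalExtr (Icc_mem_nhds hz.1 hz.2))

section
variable {a : ℝ} {P : ℂ → ℂ}

theorem continuousAt_horizontal (hP : ContinuousOn P (strip a)) {η : ℝ} (hη : |η| < a) (ξ : ℝ) :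
    ContinuousAt (fun η : ℝ => P (ξ + η * I)) η := by
  have h1 : ContinuousAt P ((ξ : ℂ) + η * I) :=
    hP.continuousAt ((isOpen_strip a).mem_nhds (ofReal_add_mul_I_mem_strip ξ hη))
  exact ContinuousAt.comp (f := fun η : ℝ => (ξ : ℂ) + η * I) h1 (by fun_prop)

theorem continuous_horizontal (hP : ContinuousOn P (strip a)) {η : ℝ} (hη : |η| < a) :
    Continuous (fun ξ : ℝ => P (ξ + η * I)) :=
  hP.comp_continuous (by fun_prop) fun ξ => ofReal_add_mul_I_mem_strip ξ hη

theorem exists_level_mem_Ioo (hP : ContinuousOn P (strip a)) {η : ℝ} (hη : |η| < a) {x y c : ℝ}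
    (hxy : x ≤ y) (hx : (P (x + η * I)).re < c) (hy : c < (P (y + η * I)).re) :
    ∃ ξ ∈ Ioo x y, (P (ξ + η * I)).re = c :=
  intermediate_value_Ioo hxy
    (Complex.continuous_re.comp (continuous_horizontal hP hη)).continuousOn ⟨hx, hy⟩

/-- Near a point of a level set of `Re P`, every nearby horizontal line meets the level set; this is
what makes the level set a continuous curve parametrized by the height. -/
theorem eventually_exists_level (hP : ContinuousOn P (strip a))
    (hmono : ∀ η : ℝ, |η| < a → StrictMono fun ξ : ℝ => (P (ξ + η * I)).re) {η : ℝ} (hη : |η| < a)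
    (ξ : ℝ) {ε : ℝ} (hε : 0 < ε) :
    ∀ᶠ η' in 𝓝 η, |η'| < a ∧
      ∃ ξ' ∈ Ioo (ξ - ε) (ξ + ε), (P (ξ' + η' * I)).re = (P (ξ + η * I)).re := by
  have h1 : ∀ᶠ η' in 𝓝 η, |η'| < a := (isOpen_lt continuous_abs continuous_const).mem_nhds hη
  have h2 := (Complex.continuous_re.continuousAt.comp
    (continuousAt_horizontal hP hη (ξ - ε))).eventually_lt_const
    (hmono η hη (show ξ - ε < ξ by linarith))
  have h3 := (Complex.continuous_re.continuousAt.comp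
    (continuousAt_horizontal hP hη (ξ + ε))).eventually_const_lt
    (hmono η hη (show ξ < ξ + ε by linarith))
  filter_upwards [h1, h2, h3] with η' h1 h2 h3
  exact ⟨h1, exists_level_mem_Ioo hP h1 (by linarith) h2 h3⟩

theorem isOpen_levelHeights (hP : ContinuousOn P (strip a))
    (hmono : ∀ η : ℝ, |η| < a → StrictMono fun ξ : ℝ => (P (ξ + η * I)).re) (c : ℝ) :
    IsOpen (levelHeights a P c) := by
  rw [isOpen_iff_mem_nhds]
  rintro η ⟨hη, ξ, rfl⟩
  filter_upwards [eventually_exists_level hP hmono hη ξ one_pos] with η' h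
  exact ⟨h.1, h.2.imp fun _ h => h.2⟩

/-- The level set `Re P = c` is a continuous curve parametrized by the height, and the
imaginary part of `P` along it is continuous and locally injective. -/
theorem exists_levelCurve (hP : ContinuousOn P (strip a))
    (hmono : ∀ η : ℝ, |η| < a → StrictMono fun ξ : ℝ => (P (ξ + η * I)).re)
    (hloc : ∀ ζ ∈ strip a, ∃ O ∈ 𝓝 ζ, InjOn P O) (c : ℝ) :
    ∃ x v : ℝ → ℝ, (∀ η ∈ levelHeights a P c, P (x η + η * I) = c + v η * I) ∧
      ContinuousOn v (levelHeights a P c) ∧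
      ∀ η ∈ levelHeights a P c, ∃ N ∈ 𝓝 η, N ⊆ levelHeights a P c ∧ InjOn v N := by
  set E := levelHeights a P c with hE
  have hEo : IsOpen E := isOpen_levelHeights hP hmono c
  have hex : ∀ η, ∃ ξ : ℝ, η ∈ E → (P (ξ + η * I)).re = c := by
    intro η
    by_cases h : η ∈ E
    · exact ⟨h.2.choose, fun _ => h.2.choose_spec⟩
    · exact ⟨0, fun h' => absurd h' h⟩
  choose x hx using hex
  have hxc : ContinuousOn x E := by
    intro η hη
    refine ContinuousAt.continuousWithinAt (Metric.continuousAt_iff'.2 fun ε hε => ?_)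
    filter_upwards [eventually_exists_level hP hmono hη.1 (x η) hε, hEo.mem_nhds hη]
      with η' ⟨h1, ξ', h2, h3⟩ h4
    have : x η' = ξ' := (hmono η' h1).injective ((hx η' h4).trans (h3.trans (hx η hη)).symm)
    rw [this, Real.dist_eq, abs_lt]
    constructor <;> linarith [h2.1, h2.2]
  have hcurve : ContinuousOn (fun η : ℝ => ((x η : ℂ) + η * I)) E := by fun_prop
  have hmem : ∀ η ∈ E, ((x η : ℂ) + η * I) ∈ strip a := fun η hη =>
    ofReal_add_mul_I_mem_strip _ hη.1
  have hPx : ∀ η ∈ E, P (x η + η * I) = c + (P (x η + η * I)).im * I := by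
    intro η hη
    apply Complex.ext <;> simp [hx η hη]
  refine ⟨x, fun η => (P (x η + η * I)).im, hPx,
    Complex.continuous_im.comp_continuousOn (hP.comp hcurve hmem), fun η hη => ?_⟩
  obtain ⟨O, hO, hinj⟩ := hloc _ (hmem η hη)
  refine ⟨E ∩ (fun η : ℝ => ((x η : ℂ) + η * I)) ⁻¹' O, ?_, inter_subset_left, ?_⟩
  · exact Filter.inter_mem (hEo.mem_nhds hη) ((hcurve.continuousAt (hEo.mem_nhds hη)) hO)
  · rintro s ⟨hs, hs'⟩ t ⟨ht, ht'⟩ hst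
    have h := hinj hs' ht' ((hPx s hs).trans
      ((congrArg (fun r : ℝ => (c + r * I : ℂ)) hst).trans (hPx t ht).symm))
    simpa using congrArg Complex.im h

/-- The section of the image of the strip under `P` by the line `Re w = c`. -/
def verticalSection (a : ℝ) (P : ℂ → ℂ) (c : ℝ) : Set ℝ := {s | (c + s * I : ℂ) ∈ P '' strip a}

theorem verticalSection_eq_image {c : ℝ} {x v : ℝ → ℝ}
    (hmono : ∀ η : ℝ, |η| < a → StrictMono fun ξ : ℝ => (P (ξ + η * I)).re)
    (h : ∀ η ∈ levelHeights a P c, P (x η + η * I) = c + v η * I) :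
    verticalSection a P c = v '' levelHeights a P c := by
  ext s
  constructor
  · rintro ⟨ζ, hζ, hs⟩
    have hre : (P (ζ.re + ζ.im * I)).re = c := by rw [Complex.re_add_im, hs]; simp
    have hE : ζ.im ∈ levelHeights a P c := ⟨hζ, ζ.re, hre⟩
    have hx : x ζ.im = ζ.re := (hmono _ hζ).injective (by simp only [hre, h _ hE]; simp)
    refine ⟨ζ.im, hE, ?_⟩
    have := h _ hE
    rw [hx, Complex.re_add_im, hs] at this
    simpa using (congrArg Complex.im this).symm
  · rintro ⟨η, hη, rfl⟩
    exact ⟨_, ofReal_add_mul_I_mem_strip (x η) hη.1, h η hη⟩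

theorem ordConnected_verticalSection (hP : ContinuousOn P (strip a))
    (hmono : ∀ η : ℝ, |η| < a → StrictMono fun ξ : ℝ => (P (ξ + η * I)).re)
    (hconn : ∀ c, OrdConnected (levelHeights a P c))
    (hloc : ∀ ζ ∈ strip a, ∃ O ∈ 𝓝 ζ, InjOn P O) (c : ℝ) :
    OrdConnected (verticalSection a P c) := by
  obtain ⟨x, v, h, hv, -⟩ := exists_levelCurve hP hmono hloc c
  rw [verticalSection_eq_image hmono h]
  exact ((hconn c).isPreconnected.image v hv).ordConnected

theorem injOn_strip (hP : ContinuousOn P (strip a))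
    (hmono : ∀ η : ℝ, |η| < a → StrictMono fun ξ : ℝ => (P (ξ + η * I)).re)
    (hconn : ∀ c, OrdConnected (levelHeights a P c))
    (hloc : ∀ ζ ∈ strip a, ∃ O ∈ 𝓝 ζ, InjOn P O) : InjOn P (strip a) := by
  intro ζ hζ ω hω heq
  obtain ⟨x, v, h, hv, hvl⟩ := exists_levelCurve hP hmono hloc (P ζ).re
  have hinj := injOn_of_locally_injOn (hconn _) hv hvl
  have hE : ζ.im ∈ levelHeights a P (P ζ).re := ⟨hζ, ζ.re, by rw [Complex.re_add_im]⟩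
  have hE' : ω.im ∈ levelHeights a P (P ζ).re := ⟨hω, ω.re, by rw [Complex.re_add_im, heq]⟩
  have hx : x ζ.im = ζ.re :=
    (hmono _ hζ).injective (by simp only [h _ hE]; rw [Complex.re_add_im]; simp)
  have hx' : x ω.im = ω.re :=
    (hmono _ hω).injective (by simp only [h _ hE']; rw [Complex.re_add_im, ← heq]; simp)
  have h1 := h _ hE
  have h2 := h _ hE'
  rw [hx, Complex.re_add_im] at h1
  rw [hx', Complex.re_add_im, ← heq] at h2
  have him : ζ.im = ω.im := hinj hE hE' (by
    have := congrArg Complex.im (h1.symm.trans h2)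
    simpa using this)
  refine Complex.ext ?_ him
  rw [← hx, ← hx', him]

/-- Each value of `P` is surrounded on every nearby vertical line by values of `P` with almost the
same imaginary part, because `Re P` increases strictly along a horizontal segment. -/
theorem eventually_exists_mem_verticalSection (hP : ContinuousOn P (strip a))
    (hmono : ∀ η : ℝ, |η| < a → StrictMono fun ξ : ℝ => (P (ξ + η * I)).re)
    {c s : ℝ} (hs : s ∈ verticalSection a P c) {V : Set ℝ} (hV : V ∈ 𝓝 s) :
    ∀ᶠ c' in 𝓝 c, ∃ s' ∈ V, s' ∈ verticalSection a P c' := by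
  obtain ⟨ζ, hζ, hPζ⟩ := hs
  have hη : |ζ.im| < a := hζ
  have hcont := continuous_horizontal hP hη
  have him : (fun ξ : ℝ => (P (ξ + ζ.im * I)).im) ⁻¹' V ∈ 𝓝 ζ.re := by
    apply (Complex.continuous_im.comp hcont).continuousAt
    simpa [Complex.re_add_im, hPζ] using hV
  obtain ⟨δ, hδ, hsub⟩ := Metric.nhds_basis_ball.mem_iff.1 him
  rw [Real.ball_eq_Ioo] at hsub
  have hre : (P (ζ.re + ζ.im * I)).re = c := by rw [Complex.re_add_im, hPζ]; simp
  have h1 := hmono _ hη (show ζ.re - δ < ζ.re by linarith)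
  have h2 := hmono _ hη (show ζ.re < ζ.re + δ by linarith)
  simp only [hre] at h1 h2
  filter_upwards [Ioo_mem_nhds h1 h2] with c' hc'
  obtain ⟨ξ, hξ, hξc⟩ := exists_level_mem_Ioo hP hη (by linarith) hc'.1 hc'.2
  refine ⟨_, hsub hξ, _, ofReal_add_mul_I_mem_strip ξ hη, ?_⟩
  apply Complex.ext <;> simp [hξc]

theorem isOpen_image_strip (hP : ContinuousOn P (strip a))
    (hmono : ∀ η : ℝ, |η| < a → StrictMono fun ξ : ℝ => (P (ξ + η * I)).re)
    (hconn : ∀ c, OrdConnected (levelHeights a P c))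
    (hloc : ∀ ζ ∈ strip a, ∃ O ∈ 𝓝 ζ, InjOn P O) : IsOpen (P '' strip a) := by
  rw [isOpen_iff_mem_nhds]
  rintro w hw
  obtain ⟨x, v, h, hv, hvl⟩ := exists_levelCurve hP hmono hloc w.re
  have hsec := verticalSection_eq_image hmono h
  have hwS : w.im ∈ verticalSection a P w.re := by
    simpa [verticalSection, Complex.re_add_im] using hw
  obtain ⟨η, hη, hηw⟩ : w.im ∈ v '' levelHeights a P w.re := hsec ▸ hwS
  obtain ⟨N, hN, hNE, hinj⟩ := hvl η hη
  have hext := not_isLocalExtr_of_injOn hN (hv.mono hNE) hinj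
  have hE := (isOpen_levelHeights hP hmono w.re).mem_nhds hη
  -- `w.im` is neither the largest nor the smallest element of its vertical section
  obtain ⟨s, hs, hsw⟩ : ∃ s ∈ verticalSection a P w.re, s < w.im := by
    by_contra! hcon
    refine hext (Or.inl ?_)
    filter_upwards [hE] with t ht
    rw [hηw]
    exact hcon _ (hsec ▸ mem_image_of_mem v ht)
  obtain ⟨t, ht, htw⟩ : ∃ t ∈ verticalSection a P w.re, w.im < t := by
    by_contra! hcon
    refine hext (Or.inr ?_)
    filter_upwards [hE] with t ht
    rw [hηw]
    exact hcon _ (hsec ▸ mem_image_of_mem v ht)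
  obtain ⟨m, hm, hm'⟩ := exists_between hsw
  obtain ⟨M, hM, hM'⟩ := exists_between htw
  have h1 := Complex.continuous_re.continuousAt.eventually
    (eventually_exists_mem_verticalSection hP hmono hs (Iio_mem_nhds hm))
  have h2 := Complex.continuous_re.continuousAt.eventually
    (eventually_exists_mem_verticalSection hP hmono ht (Ioi_mem_nhds hM'))
  have h3 := Complex.continuous_im.continuousAt.eventually (Ioo_mem_nhds hm' hM)
  filter_upwards [h1, h2, h3] with z ⟨s', hs', hz1⟩ ⟨t', ht', hz2⟩ hz3
  have : z.im ∈ verticalSection a P z.re :=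
    (ordConnected_verticalSection hP hmono hconn hloc z.re).out hz1 hz2
      ⟨(hs'.trans hz3.1).le, (hz3.2.trans ht').le⟩
  simpa [verticalSection, Complex.re_add_im] using this

end

/-! ### The hyperbolic tangent between a strip and the disk -/

/-- The hyperbolic tangent, written as a Möbius transform of `exp (2ζ)`. -/
noncomputable def stripMap (ζ : ℂ) : ℂ := (exp (2 * ζ) - 1) / (exp (2 * ζ) + 1)

theorem re_exp_pos_of_mem_strip {ζ : ℂ} (hζ : ζ ∈ strip (Real.pi / 4)) :
    0 < (exp (2 * ζ)).re := by
  have h := abs_lt.1 (show |ζ.im| < Real.pi / 4 from hζ)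
  rw [Complex.exp_re]
  refine mul_pos (Real.exp_pos _) (Real.cos_pos_of_mem_Ioo ⟨?_, ?_⟩) <;>
    simp <;> linarith [h.1, h.2]

theorem exp_add_one_ne_zero {ζ : ℂ} (hζ : ζ ∈ strip (Real.pi / 4)) : exp (2 * ζ) + 1 ≠ 0 := by
  intro h
  have h1 := re_exp_pos_of_mem_strip hζ
  have h2 := congrArg Complex.re h
  simp only [add_re, one_re, zero_re] at h2
  linarith

theorem stripMap_mem_unitDisk {ζ : ℂ} (hζ : ζ ∈ strip (Real.pi / 4)) :
    stripMap ζ ∈ unitDisk := by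
  have h := re_exp_pos_of_mem_strip hζ
  rw [mem_unitDisk, stripMap, norm_div, div_lt_one (norm_pos_iff.2 (exp_add_one_ne_zero hζ)),
    ← sq_lt_sq₀ (norm_nonneg _) (norm_nonneg _), ← Complex.normSq_eq_norm_sq,
    ← Complex.normSq_eq_norm_sq, Complex.normSq_apply, Complex.normSq_apply]
  simp only [sub_re, add_re, one_re, sub_im, add_im, one_im]
  nlinarith

theorem hasDerivAt_stripMap {ζ : ℂ} (hζ : ζ ∈ strip (Real.pi / 4)) :
    HasDerivAt stripMap (1 - stripMap ζ ^ 2) ζ := by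
  have h0 := exp_add_one_ne_zero hζ
  have h1 : HasDerivAt (fun ζ : ℂ => exp (2 * ζ)) (exp (2 * ζ) * (2 * 1)) ζ :=
    ((hasDerivAt_id ζ).const_mul 2).cexp
  refine ((h1.sub_const 1).div (h1.add_const 1) h0).congr_deriv ?_
  rw [stripMap]
  field_simp
  ring

theorem continuousOn_stripMap : ContinuousOn stripMap (strip (Real.pi / 4)) := fun _ hζ =>
  (hasDerivAt_stripMap hζ).continuousAt.continuousWithinAt

theorem half_log_stripMap {ζ : ℂ} (hζ : ζ ∈ strip (Real.pi / 4)) :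
    (1 / 2 : ℂ) * Complex.log ((1 + stripMap ζ) / (1 - stripMap ζ)) = ζ := by
  have h0 := exp_add_one_ne_zero hζ
  have h := abs_lt.1 (show |ζ.im| < Real.pi / 4 from hζ)
  have h1 : (1 + stripMap ζ) / (1 - stripMap ζ) = exp (2 * ζ) := by
    have h2 := one_sub_ne_zero_of_mem_unitDisk (stripMap_mem_unitDisk hζ)
    rw [div_eq_iff h2, stripMap]
    field_simp
    ring
  rw [h1, Complex.log_exp]
  · ring
  · simp; linarith [h.1, Real.pi_pos]
  · simp; linarith [h.2, Real.pi_pos]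

theorem injOn_stripMap : InjOn stripMap (strip (Real.pi / 4)) := by
  intro ζ hζ ω hω h
  rw [← half_log_stripMap hζ, ← half_log_stripMap hω, h]

theorem image_stripMap : stripMap '' strip (Real.pi / 4) = unitDisk := by
  refine Subset.antisymm (image_subset_iff.2 fun ζ hζ => stripMap_mem_unitDisk hζ) fun z hz => ?_
  have hpos := re_one_add_div_one_sub_pos hz
  have h1 := one_sub_ne_zero_of_mem_unitDisk hz
  have hne : (1 + z) / (1 - z) ≠ 0 := fun h => by simp [h] at hpos
  refine ⟨(1 / 2 : ℂ) * Complex.log ((1 + z) / (1 - z)), ?_, ?_⟩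
  · have h2 := abs_arg_lt_pi_div_two_iff.2 (Or.inl hpos)
    have h3 : ((1 / 2 : ℂ) * Complex.log ((1 + z) / (1 - z))).im
        = 1 / 2 * arg ((1 + z) / (1 - z)) := by
      rw [← Complex.log_im]; simp [Complex.mul_im]
    rw [strip, mem_ofPred_eq, h3, abs_mul, abs_of_pos (by norm_num : (0 : ℝ) < 1 / 2)]
    linarith
  · have h4 := one_add_ne_zero_of_mem_unitDisk hz
    rw [stripMap, ← mul_assoc, show (2 : ℂ) * (1 / 2) = 1 by norm_num, one_mul,
      Complex.exp_log hne]
    have h5 : (1 + z) / (1 - z) + 1 ≠ 0 := by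
      rw [show (1 + z) / (1 - z) + 1 = 2 / (1 - z) by field_simp; ring]
      exact div_ne_zero two_ne_zero h1
    rw [div_eq_iff h5]
    field_simp
    ring

/-! ### The shear construction -/

/-- If `Re ((1 - z²) φ'(z)) > 0`, then a locally injective continuous map with real part `Re φ` is
univalent and convex in the direction of the imaginary axis. -/
theorem univalent_and_convexInImaginaryDirection {φ F : ℂ → ℂ} (hF : ContinuousOn F unitDisk)
    (hφ : ∀ z ∈ unitDisk, DifferentiableAt ℂ φ z)
    (hpos : ∀ z ∈ unitDisk, 0 < ((1 - z ^ 2) * deriv φ z).re)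
    (hre : ∀ z ∈ unitDisk, (F z).re = (φ z).re) (hloc : LocallyUnivalent F) :
    Univalent F ∧ ConvexInImaginaryDirection F := by
  set a : ℝ := Real.pi / 4 with ha
  set P : ℂ → ℂ := F ∘ stripMap with hPdef
  set Φ : ℂ → ℂ := φ ∘ stripMap with hΦdef
  have hmaps : MapsTo stripMap (strip a) unitDisk := fun ζ hζ => stripMap_mem_unitDisk hζ
  have himg : P '' strip a = F '' unitDisk := by rw [hPdef, image_comp, image_stripMap]
  have hPre : ∀ ζ ∈ strip a, (P ζ).re = (Φ ζ).re := fun ζ hζ => hre _ (hmaps hζ)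
  have hP : ContinuousOn P (strip a) := hF.comp continuousOn_stripMap hmaps
  have hΦ' : ∀ ζ ∈ strip a,
      HasDerivAt Φ (deriv φ (stripMap ζ) * (1 - stripMap ζ ^ 2)) ζ := fun ζ hζ =>
    (hφ _ (hmaps hζ)).hasDerivAt.comp ζ (hasDerivAt_stripMap hζ)
  have hΦ : DifferentiableOn ℂ Φ (strip a) := fun ζ hζ =>
    (hΦ' ζ hζ).differentiableAt.differentiableWithinAt
  have hmonoΦ : ∀ η : ℝ, |η| < a → StrictMono fun ξ : ℝ => (Φ (ξ + η * I)).re := by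
    intro η hη
    have hd : ∀ ξ : ℝ, HasDerivAt (fun ξ : ℝ => (Φ (ξ + η * I)).re)
        (deriv φ (stripMap (ξ + η * I)) * (1 - stripMap (ξ + η * I) ^ 2)).re ξ := by
      intro ξ
      have h1 := hΦ' _ (ofReal_add_mul_I_mem_strip ξ hη)
      have h2 : HasDerivAt (fun ζ : ℂ => Φ (ζ + η * I))
          (deriv φ (stripMap (ξ + η * I)) * (1 - stripMap (ξ + η * I) ^ 2)) (ξ : ℂ) := by
        simpa using h1.comp_add_const (ξ : ℂ) (η * I)
      exact h2.real_of_complex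
    refine strictMono_of_hasDerivAt_pos hd fun ξ => ?_
    rw [mul_comm]
    exact hpos _ (hmaps (ofReal_add_mul_I_mem_strip ξ hη))
  have hmono : ∀ η : ℝ, |η| < a → StrictMono fun ξ : ℝ => (P (ξ + η * I)).re := by
    intro η hη
    have : (fun ξ : ℝ => (P (ξ + η * I)).re) = fun ξ : ℝ => (Φ (ξ + η * I)).re :=
      funext fun ξ => hPre _ (ofReal_add_mul_I_mem_strip ξ hη)
    rw [this]
    exact hmonoΦ η hη
  have hconn : ∀ c, OrdConnected (levelHeights a P c) := by
    intro c
    have : levelHeights a P c = levelHeights a Φ c := by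
      ext η
      refine and_congr_right fun hη => exists_congr fun ξ => ?_
      rw [hPre _ (ofReal_add_mul_I_mem_strip ξ hη)]
    rw [this]
    exact ordConnected_levelHeights hΦ hmonoΦ c
  have hlocP : ∀ ζ ∈ strip a, ∃ O ∈ 𝓝 ζ, InjOn P O := by
    intro ζ hζ
    obtain ⟨U, hU, hzU, -, hinj⟩ := hloc _ (hmaps hζ)
    refine ⟨strip a ∩ stripMap ⁻¹' U,
      Filter.inter_mem ((isOpen_strip a).mem_nhds hζ) ?_, ?_⟩
    · exact (hasDerivAt_stripMap hζ).continuousAt (hU.mem_nhds hzU)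
    · exact fun ζ₁ h₁ ζ₂ h₂ h => injOn_stripMap h₁.1 h₂.1 (hinj h₁.2 h₂.2 h)
  refine ⟨?_, ?_, ?_, ?_⟩
  · have h := injOn_strip hP hmono hconn hlocP
    rw [Univalent, ← image_stripMap]
    rintro _ ⟨ζ, hζ, rfl⟩ _ ⟨ω, hω, rfl⟩ heq
    rw [h hζ hω heq]
  · rw [← himg]
    exact isOpen_image_strip hP hmono hconn hlocP
  · refine IsConnected.image ⟨⟨0, by simp [mem_unitDisk]⟩, ?_⟩ F hF
    exact (convex_ball (0 : ℂ) 1).isPreconnected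
  · intro w
    have hsec := (ordConnected_verticalSection hP hmono hconn hlocP w.re).isPreconnected
    have hI : exp (((Real.pi / 2 : ℝ) : ℂ) * I) = I := by
      push_cast; exact Complex.exp_pi_div_two_mul_I
    have : F '' unitDisk ∩ {z | ∃ t : ℝ, z = w + t * exp (((Real.pi / 2 : ℝ) : ℂ) * I)} =
        (fun s : ℝ => (w.re + s * I : ℂ)) '' verticalSection a P w.re := by
      rw [hI, ← himg]
      ext z
      constructor
      · rintro ⟨hz, t, ht⟩
        have hzr : z.re = w.re := by simp [ht]
        have e : (w.re + z.im * I : ℂ) = z := by rw [← hzr, Complex.re_add_im]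
        exact ⟨z.im, by rwa [verticalSection, mem_ofPred_eq, e], e⟩
      · rintro ⟨s, hs, rfl⟩
        refine ⟨hs, s - w.im, ?_⟩
        apply Complex.ext <;> simp
    rw [this]
    exact hsec.image _ (by fun_prop)

/-! ### Derivatives of the analytic and co-analytic parts -/

theorem det_eq_of_apply (A : ℂ →L[ℝ] ℂ) :
    A.det = (A 1).re * (A I).im - (A I).re * (A 1).im := by
  rw [ContinuousLinearMap.det, ← LinearMap.det_toMatrix Complex.basisOneI, Matrix.det_fin_two]
  simp [LinearMap.toMatrix_apply]

theorem det_fderiv_add_conj {f h g : ℂ → ℂ} (hd : IsCanonicalDecomposition f h g) {z : ℂ}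
    (hz : z ∈ unitDisk) :
    (fderiv ℝ f z).det = ‖deriv h z‖ ^ 2 - ‖deriv g z‖ ^ 2 := by
  have hD := isOpen_unitDisk.mem_nhds hz
  have h1 := ((hd.analytic_h.differentiableAt hD).hasDerivAt.hasFDerivAt.restrictScalars ℝ)
  have h2 := ((hd.analytic_g.differentiableAt hD).hasDerivAt.hasFDerivAt.restrictScalars ℝ)
  have h3 := h1.add (conjCLE.hasFDerivAt.comp z h2)
  have hev : f =ᶠ[𝓝 z] (h + conjCLE ∘ g) := by
    filter_upwards [hD] with w hw
    simpa using hd.eq_add_conj w hw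
  rw [(h3.congr_of_eventuallyEq hev).fderiv, det_eq_of_apply, ← Complex.normSq_eq_norm_sq,
    ← Complex.normSq_eq_norm_sq, Complex.normSq_apply, Complex.normSq_apply]
  simp
  ring

theorem norm_deriv_lt_of_sensePreserving {f h g : ℂ → ℂ} (hf : SensePreserving f)
    (hd : IsCanonicalDecomposition f h g) {z : ℂ} (hz : z ∈ unitDisk) :
    ‖deriv g z‖ < ‖deriv h z‖ := by
  have := hf z hz
  rw [det_fderiv_add_conj hd hz, sub_pos] at this
  exact lt_of_pow_lt_pow_left₀ 2 (norm_nonneg _) this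

theorem re_add_div_sub_pos {u v : ℂ} (h : ‖v‖ < ‖u‖) : 0 < ((u + v) / (u - v)).re := by
  have hne : u - v ≠ 0 := by
    intro h0
    rw [sub_eq_zero.1 h0] at h
    exact lt_irrefl _ h
  have h2 : v.re * v.re + v.im * v.im < u.re * u.re + u.im * u.im := by
    rw [← Complex.normSq_apply, ← Complex.normSq_apply, Complex.normSq_eq_norm_sq,
      Complex.normSq_eq_norm_sq]
    exact pow_lt_pow_left₀ h (norm_nonneg _) two_ne_zero
  rw [Complex.div_re, ← add_div]
  apply div_pos _ (Complex.normSq_pos.2 hne)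
  simp only [add_re, sub_re, add_im, sub_im]
  nlinarith

/-! ### A mean value estimate in a half-plane -/

theorem neg_half_lt_re_div_one_sub {z : ℂ} (hz : z ∈ unitDisk) : -(1 / 2) < (z / (1 - z)).re := by
  have h1 := one_sub_ne_zero_of_mem_unitDisk hz
  have h := re_one_add_div_one_sub_pos hz
  have e : (1 + z) / (1 - z) = 1 + (z / (1 - z) + z / (1 - z)) := by field_simp; ring
  rw [e, add_re, add_re, one_re] at h
  linarith

theorem div_one_add_mem_unitDisk {w : ℂ} (hw : -(1 / 2) < w.re) :
    1 + w ≠ 0 ∧ w / (1 + w) ∈ unitDisk := by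
  have hne : 1 + w ≠ 0 := by
    intro h
    have := congrArg Complex.re h
    simp only [add_re, one_re, zero_re] at this
    linarith
  refine ⟨hne, ?_⟩
  rw [mem_unitDisk, norm_div, div_lt_one (norm_pos_iff.2 hne),
    ← sq_lt_sq₀ (norm_nonneg _) (norm_nonneg _), ← Complex.normSq_eq_norm_sq,
    ← Complex.normSq_eq_norm_sq, Complex.normSq_apply, Complex.normSq_apply]
  simp only [add_re, one_re, add_im, one_im]
  nlinarith

/-- In the coordinate `w = z / (1 - z)`, which maps the disk onto the half-plane `Re w > -1/2`, the
hypothesis says that the derivative has nonnegative real part. The points `z` and `-z` correspond to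
`w₂` and `w₁` with `w₂ - w₁ = 2z / (1 - z²)`, so the quantity in question is the mean of that
derivative along the segment from `w₁` to `w₂`. -/
theorem re_mul_sub_neg_div_nonneg {k : ℂ → ℂ} (hk : DifferentiableOn ℂ k unitDisk)
    (hpos : ∀ z ∈ unitDisk, 0 ≤ ((1 - z) ^ 2 * deriv k z).re) {z : ℂ} (hz : z ∈ unitDisk)
    (hz0 : z ≠ 0) : 0 ≤ ((1 - z ^ 2) * ((k z - k (-z)) / (2 * z))).re := by
  have h1 := one_sub_ne_zero_of_mem_unitDisk hz
  have h2 := one_add_ne_zero_of_mem_unitDisk hz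
  set w₁ : ℂ := -z / (1 - -z) with hw₁
  set w₂ : ℂ := z / (1 - z) with hw₂
  set d : ℂ := w₂ - w₁ with hd
  have hd' : d = 2 * z / ((1 - z) * (1 + z)) := by
    rw [hd, hw₁, hw₂, sub_neg_eq_add]; field_simp; ring
  have hd0 : d ≠ 0 := by
    rw [hd']; exact div_ne_zero (mul_ne_zero two_ne_zero hz0) (mul_ne_zero h1 h2)
  set γ : ℂ → ℂ := fun t => k ((w₁ + t * d) / (1 + (w₁ + t * d))) / d with hγ
  have hre : ∀ t ∈ Icc (0 : ℝ) 1, -(1 / 2) < (w₁ + t * d).re := by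
    intro t ht
    have e₁ := neg_half_lt_re_div_one_sub (neg_mem_unitDisk hz)
    have e₂ := neg_half_lt_re_div_one_sub hz
    have e : (w₁ + t * d).re = (1 - t) * w₁.re + t * w₂.re := by
      rw [hd, add_re, re_ofReal_mul, sub_re]; ring
    rw [e]
    rcases ht.1.eq_or_lt with h | h
    · rw [← h, sub_zero, one_mul, zero_mul, add_zero]; exact e₁
    · nlinarith [mul_lt_mul_of_pos_left e₂ h, mul_le_mul_of_nonneg_left e₁.le (sub_nonneg.2 ht.2)]
  have hder : ∀ t ∈ Icc (0 : ℝ) 1, ∃ p : ℂ, 0 ≤ p.re ∧ HasDerivAt γ p t := by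
    intro t ht
    obtain ⟨hne, hm⟩ := div_one_add_mem_unitDisk (hre t ht)
    set w : ℂ := w₁ + t * d with hw
    refine ⟨(1 - w / (1 + w)) ^ 2 * deriv k (w / (1 + w)), hpos _ hm, ?_⟩
    have hlin : HasDerivAt (fun t : ℂ => w₁ + t * d) d (t : ℂ) := by
      simpa using ((hasDerivAt_id (t : ℂ)).mul_const d).const_add w₁
    have hmob := hlin.div (hlin.const_add 1) hne
    have hkd := (hk.differentiableAt (isOpen_unitDisk.mem_nhds hm)).hasDerivAt
    have := (HasDerivAt.comp (t : ℂ) (h₂ := k) hkd hmob).div_const d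
    refine this.congr_deriv ?_
    rw [← hw]
    field_simp
    ring
  have hreal : ∀ t ∈ Icc (0 : ℝ) 1, ∃ p : ℝ, 0 ≤ p ∧
      HasDerivAt (fun t : ℝ => (γ t).re) p t := fun t ht => by
    obtain ⟨p, hp, hp'⟩ := hder t ht
    exact ⟨p.re, hp, hp'.real_of_complex⟩
  have hmono : MonotoneOn (fun t : ℝ => (γ t).re) (Icc 0 1) := by
    refine monotoneOn_of_deriv_nonneg (convex_Icc 0 1) (fun t ht => ?_) (fun t ht => ?_)
      (fun t ht => ?_)
    · obtain ⟨p, -, hp⟩ := hreal t ht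
      exact hp.continuousAt.continuousWithinAt
    · obtain ⟨p, -, hp⟩ := hreal t (interior_subset ht)
      exact hp.differentiableAt.differentiableWithinAt
    · obtain ⟨p, hp0, hp⟩ := hreal t (interior_subset ht)
      rw [hp.deriv]
      exact hp0
  have h01 := hmono (left_mem_Icc.2 zero_le_one) (right_mem_Icc.2 zero_le_one) zero_le_one
  have e0 : γ (0 : ℝ) = k (-z) / d := by
    have : (w₁ + ((0 : ℝ) : ℂ) * d) / (1 + (w₁ + ((0 : ℝ) : ℂ) * d)) = -z := by
      rw [hw₁, sub_neg_eq_add]; push_cast; field_simp; ring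
    simp only [hγ, this]
  have e1 : γ (1 : ℝ) = k z / d := by
    have : (w₁ + ((1 : ℝ) : ℂ) * d) / (1 + (w₁ + ((1 : ℝ) : ℂ) * d)) = z := by
      have : w₁ + ((1 : ℝ) : ℂ) * d = w₂ := by rw [hd]; push_cast; ring
      rw [this, hw₂]; field_simp; ring
    simp only [hγ, this]
  simp only [e0, e1] at h01
  have e : (1 - z ^ 2) * ((k z - k (-z)) / (2 * z)) = k z / d - k (-z) / d := by
    rw [hd']; field_simp; ring
  rw [e, sub_re, sub_nonneg]
  exact h01

/-! ### The convolution -/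

theorem hasSum_odd_part {c : ℕ → ℂ} {k : ℂ → ℂ}
    (hk : ∀ z ∈ unitDisk, HasSum (fun n => c n * z ^ n) (k z)) {z : ℂ} (hz : z ∈ unitDisk) :
    HasSum (fun n : ℕ => (if Odd n then c n else 0) * z ^ n) ((k z - k (-z)) / 2) := by
  refine (((hk z hz).sub (hk _ (neg_mem_unitDisk hz))).div_const 2).congr_fun fun n => ?_
  rcases Nat.even_or_odd n with hn | hn
  · simp [Nat.not_odd_iff_even.2 hn, hn.neg_pow]
  · simp [hn, hn.neg_pow]

theorem hasDerivAt_div_one_sub {z : ℂ} (hz : z ∈ unitDisk) :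
    HasDerivAt (fun z : ℂ => z / (1 - z)) (1 / (1 - z) ^ 2) z := by
  have h1 := one_sub_ne_zero_of_mem_unitDisk hz
  refine ((hasDerivAt_id z).div ((hasDerivAt_id z).const_sub 1) h1).congr_deriv ?_
  simp only [id_eq]
  field_simp
  ring

/-- The coefficients `c n` of `½ log ((1 + z) / (1 - z))` satisfy `n * c n = 1` for odd `n` and
`n * c n = 0` for even `n`. -/
theorem natCast_mul_coeff_half_log {c : ℕ → ℂ} {L : ℂ → ℂ}
    (hL : ∀ z ∈ unitDisk, L z = (1 / 2 : ℂ) * Complex.log ((1 + z) / (1 - z)))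
    (hc : ∀ z ∈ unitDisk, HasSum (fun n => c n * z ^ n) (L z)) (n : ℕ) :
    n * c n = if Odd n then 1 else 0 := by
  have hder : ∀ z ∈ unitDisk, z * deriv L z = z / (1 - z ^ 2) := by
    intro z hz
    have hev : L =ᶠ[𝓝 z] fun z => (1 / 2 : ℂ) * Complex.log ((1 + z) / (1 - z)) := by
      filter_upwards [isOpen_unitDisk.mem_nhds hz] with w hw using hL w hw
    rw [hev.deriv_eq, (hasDerivAt_half_log hz).deriv, mul_one_div]
  refine congrFun (coeff_eq_of_hasSum (c := fun n => n * c n)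
    (c' := fun n => if Odd n then 1 else 0) (f := fun z => z / (1 - z ^ 2)) (fun z hz => ?_)
    fun z hz => hasSum_div_one_sub_sq hz) n
  have h := (differentiableAt_and_hasSum_mul_deriv hc hz).2
  rwa [hder z hz] at h

/-- Let `Q` be the Hadamard product of `k` with a series `∑ l n * z ^ n` such that `n * l n` is `1`
for odd `n` and `0` for even `n`. Then `z Q'(z)` is the odd part of `k`. -/
theorem re_mul_deriv_nonneg {b l : ℕ → ℂ} {k Q : ℂ → ℂ} (hk : DifferentiableOn ℂ k unitDisk)
    (hb : ∀ z ∈ unitDisk, HasSum (fun n => b n * z ^ n) (k z))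
    (hl : ∀ n : ℕ, n * l n = if Odd n then 1 else 0)
    (hQ : ∀ z ∈ unitDisk, HasSum (fun n => b n * l n * z ^ n) (Q z))
    (hpos : ∀ z ∈ unitDisk, 0 ≤ ((1 - z) ^ 2 * deriv k z).re) {z : ℂ} (hz : z ∈ unitDisk) :
    0 ≤ ((1 - z ^ 2) * deriv Q z).re := by
  rcases eq_or_ne z 0 with rfl | hz0
  · have h1 : l 1 = 1 := by simpa using hl 1
    have := hpos 0 hz
    rw [deriv_zero_eq_coeff_one hQ, h1, mul_one, ← deriv_zero_eq_coeff_one hb]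
    simpa using this
  · have h := (differentiableAt_and_hasSum_mul_deriv hQ hz).2
    have h' : HasSum (fun n : ℕ => (if Odd n then b n else 0) * z ^ n) (z * deriv Q z) := by
      refine h.congr_fun fun n => ?_
      rw [show (n : ℂ) * (b n * l n) = b n * (n * l n) by ring, hl]
      split_ifs <;> simp
    have e : deriv Q z = (k z - k (-z)) / (2 * z) := by
      have := h'.unique (hasSum_odd_part hb hz)
      field_simp
      linear_combination 2 * this
    rw [e]
    exact re_mul_sub_neg_div_nonneg hk hpos hz hz0

theorem continuousOn_analyticConv {h k : ℂ → ℂ} (hh : DifferentiableOn ℂ h unitDisk)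
    (hk : DifferentiableOn ℂ k unitDisk) : ContinuousOn (analyticConv h k) unitDisk := fun _ hz =>
  (differentiableAt_and_hasSum_mul_deriv (fun _ hw => hasSum_analyticConv hh hk hw)
    hz).1.continuousAt.continuousWithinAt

/-- Since Hadamard multiplication by `h₁ - g₁ = z / (1 - z)` fixes functions vanishing at `0`,
`2 (h₁ * h₂ + g₁ * g₂) = (h₁ + g₁) * (h₂ + g₂) + (h₂ - g₂)`. This is read off from the Taylor
coefficients; the two terms on the right are estimated by `re_mul_deriv_nonneg` and by the
sense-preserving property of `f₂`. -/
theorem re_mul_deriv_analyticConv_add_pos {f₁ h₁ g₁ f₂ h₂ g₂ : ℂ → ℂ}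
    (hf₁ : SensePreserving f₁) (hd₁ : IsCanonicalDecomposition f₁ h₁ g₁)
    (hf₂ : SensePreserving f₂) (hd₂ : IsCanonicalDecomposition f₂ h₂ g₂)
    (hφ₁ : ∀ z ∈ unitDisk, h₁ z - g₁ z = z / (1 - z))
    (hφ₂ : ∀ z ∈ unitDisk, h₂ z + g₂ z = (1 / 2 : ℂ) * Complex.log ((1 + z) / (1 - z)))
    {z : ℂ} (hz : z ∈ unitDisk) :
    0 < ((1 - z ^ 2) * deriv (fun z => analyticConv h₁ h₂ z + analyticConv g₁ g₂ z) z).re := by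
  set φ : ℂ → ℂ := fun z => analyticConv h₁ h₂ z + analyticConv g₁ g₂ z with hφdef
  set a := taylorCoeff h₁
  set b := taylorCoeff g₁
  set A := taylorCoeff h₂
  set B := taylorCoeff g₂
  have hφs : ∀ z ∈ unitDisk, HasSum (fun n => (a n * A n + b n * B n) * z ^ n) (φ z) :=
    fun z hz => ((hasSum_analyticConv hd₁.analytic_h hd₂.analytic_h hz).add
      (hasSum_analyticConv hd₁.analytic_g hd₂.analytic_g hz)).congr_fun fun n => by ring
  have hk : ∀ z ∈ unitDisk, HasSum (fun n => (a n + b n) * z ^ n) ((h₁ + g₁) z) := fun z hz =>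
    ((hasSum_taylorCoeff hd₁.analytic_h hz).add
      (hasSum_taylorCoeff hd₁.analytic_g hz)).congr_fun fun n => by ring
  have hL : ∀ z ∈ unitDisk, HasSum (fun n => (A n + B n) * z ^ n) ((h₂ + g₂) z) := fun z hz =>
    ((hasSum_taylorCoeff hd₂.analytic_h hz).add
      (hasSum_taylorCoeff hd₂.analytic_g hz)).congr_fun fun n => by ring
  have hM : ∀ z ∈ unitDisk, HasSum (fun n => (A n - B n) * z ^ n) ((h₂ - g₂) z) := fun z hz =>
    ((hasSum_taylorCoeff hd₂.analytic_h hz).sub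
      (hasSum_taylorCoeff hd₂.analytic_g hz)).congr_fun fun n => by ring
  have hab : (fun n => a n - b n) = fun n => if n = 0 then 0 else 1 := by
    refine coeff_eq_of_hasSum (f := fun z => z / (1 - z)) (fun z hz => ?_)
      fun z hz => hasSum_div_one_sub hz
    rw [← hφ₁ z hz]
    exact ((hasSum_taylorCoeff hd₁.analytic_h hz).sub
      (hasSum_taylorCoeff hd₁.analytic_g hz)).congr_fun fun n => by ring
  have hl := natCast_mul_coeff_half_log hφ₂ hL
  have h0D : (0 : ℂ) ∈ unitDisk := by simp [mem_unitDisk]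
  have hAB0 : A 0 - B 0 = 0 := by
    have hg := hd₂.g_zero
    have h := hφ₂ 0 h0D
    simp only [hg, add_zero, sub_zero, div_one, Complex.log_one, mul_zero] at h
    simp [A, B, taylorCoeff, hg, h]
  -- the coefficientwise form of the identity for `2 (h₁ * h₂ + g₁ * g₂)`
  have hQ : ∀ z ∈ unitDisk, HasSum (fun n => (a n + b n) * (A n + B n) * z ^ n)
      (2 * φ z - (h₂ - g₂) z) := by
    intro z hz
    refine (((hφs z hz).mul_left 2).sub (hM z hz)).congr_fun fun n => ?_
    have hn : (a n - b n) * (A n - B n) = A n - B n := by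
      have := congrFun hab n
      rw [this]
      rcases eq_or_ne n 0 with rfl | hn
      · simp [hAB0]
      · simp [hn]
    linear_combination (-z ^ n) * hn
  have hD := isOpen_unitDisk.mem_nhds hz
  have hpos : ∀ z ∈ unitDisk, 0 ≤ ((1 - z) ^ 2 * deriv (h₁ + g₁) z).re := by
    intro z hz
    have hD := isOpen_unitDisk.mem_nhds hz
    have dh := hd₁.analytic_h.differentiableAt hD
    have dg := hd₁.analytic_g.differentiableAt hD
    have hev : (h₁ - g₁) =ᶠ[𝓝 z] fun z => z / (1 - z) := by
      filter_upwards [hD] with w hw using hφ₁ w hw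
    have e := hev.deriv_eq
    rw [deriv_sub dh dg, (hasDerivAt_div_one_sub hz).deriv] at e
    have hp := re_add_div_sub_pos (norm_deriv_lt_of_sensePreserving hf₁ hd₁ hz)
    rw [e, div_div_eq_mul_div, div_one, mul_comm] at hp
    rw [deriv_add dh dg]
    exact hp.le
  have hQpos := re_mul_deriv_nonneg (hd₁.analytic_h.add hd₁.analytic_g) hk hl hQ hpos hz
  have dh := hd₂.analytic_h.differentiableAt hD
  have dg := hd₂.analytic_g.differentiableAt hD
  have dφ := (differentiableAt_and_hasSum_mul_deriv hφs hz).1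
  have hMpos : 0 < ((1 - z ^ 2) * deriv (h₂ - g₂) z).re := by
    have hev : (h₂ + g₂) =ᶠ[𝓝 z] fun z => (1 / 2 : ℂ) * Complex.log ((1 + z) / (1 - z)) := by
      filter_upwards [hD] with w hw using hφ₂ w hw
    have e := hev.deriv_eq
    rw [deriv_add dh dg, (hasDerivAt_half_log hz).deriv] at e
    have hp := re_add_div_sub_pos (u := deriv h₂ z) (v := -deriv g₂ z)
      (by rw [norm_neg]; exact norm_deriv_lt_of_sensePreserving hf₂ hd₂ hz)
    rw [sub_neg_eq_add, e, div_div_eq_mul_div, div_one, mul_comm] at hp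
    rwa [deriv_sub dh dg, sub_eq_add_neg]
  have hsum : deriv (fun z => 2 * φ z - (h₂ - g₂) z) z = 2 * deriv φ z - deriv (h₂ - g₂) z := by
    rw [deriv_fun_sub (dφ.const_mul 2) (dh.sub dg), deriv_const_mul_field]
  rw [hsum] at hQpos
  have e : ((1 - z ^ 2) * (2 * deriv φ z - deriv (h₂ - g₂) z)).re =
      2 * ((1 - z ^ 2) * deriv φ z).re - ((1 - z ^ 2) * deriv (h₂ - g₂) z).re := by
    rw [mul_sub, sub_re, mul_left_comm]
    simp
  linarith

end HarmonicMapping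

theorem theoremt8 (f₁ h₁ g₁ f₂ h₂ g₂ : ℂ → ℂ)
    (hf₁ : HarmonicMapping.ClassSH0 f₁)
    (hd₁ : HarmonicMapping.IsCanonicalDecomposition f₁ h₁ g₁)
    (hf₂ : HarmonicMapping.ClassSH0 f₂)
    (hd₂ : HarmonicMapping.IsCanonicalDecomposition f₂ h₂ g₂)
    (hφ₁ : ∀ z ∈ HarmonicMapping.unitDisk, h₁ z - g₁ z = z / (1 - z))
    (hφ₂ : ∀ z ∈ HarmonicMapping.unitDisk,
      h₂ z + g₂ z = (1 / 2 : ℂ) * Complex.log ((1 + z) / (1 - z)))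
    (hloc : HarmonicMapping.LocallyUnivalent (HarmonicMapping.harmonicConv h₁ g₁ h₂ g₂)) :
    HarmonicMapping.Univalent (HarmonicMapping.harmonicConv h₁ g₁ h₂ g₂) ∧
      HarmonicMapping.ConvexInImaginaryDirection
        (HarmonicMapping.harmonicConv h₁ g₁ h₂ g₂) := by
  open HarmonicMapping in
  refine univalent_and_convexInImaginaryDirection
    (φ := fun z => analyticConv h₁ h₂ z + analyticConv g₁ g₂ z) ?_ (fun z hz => ?_)
    (fun z hz => re_mul_deriv_analyticConv_add_pos hf₁.sensePreserving hd₁ hf₂.sensePreserving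
      hd₂ hφ₁ hφ₂ hz) (fun z _ => ?_) hloc
  · exact (continuousOn_analyticConv hd₁.analytic_h hd₂.analytic_h).add
      (Complex.continuous_conj.comp_continuousOn
        (continuousOn_analyticConv hd₁.analytic_g hd₂.analytic_g))
  · exact (differentiableAt_and_hasSum_mul_deriv
      (fun _ hw => hasSum_analyticConv hd₁.analytic_h hd₂.analytic_h hw) hz).1.add
      (differentiableAt_and_hasSum_mul_deriv
        (fun _ hw => hasSum_analyticConv hd₁.analytic_g hd₂.analytic_g hw) hz).1
  · simp [harmonicConv]
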